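/- Let $L(\mathbb{R}^3)$ be the orthomodular lattice (OML) of all linear subspaces of Euclidean space $\mathbb{R}^3$, ordered by inclusion, with the orthogonal complement as orthocomplementation $'$. A *subOML* of an OML is a subset that contains $0$ and $1$ and is closed under $\vee$, $\wedge$ and $'$; an OML is *locally finite* if each of its finite subsets generates a finite subOML. A *two-valued state* on an OML $L$ is a function $s : L \to \{0,1\}$ with $s(1)=1$ and $s(a \vee b) = s(a)+s(b)$ whenever $a \le b'$. A set $S$ of such states is *order determining* if $a \le b$ whenever $s(a) \le s(b)$ for all $s \in S$. An OML is *set-representable* if it is isomorphic, as an orthocomplemented ordered set, to a family of subsets of some set $X$, ordered by inclusion and with the set complement as orthocomplementation, that contains $X$ and is closed under complements and under unions of disjoint pairs. **Theorem 1.3.** There is no two-valued state on $L(\mathbb{R}^3)$. Yet every finite subOML $K$ of $L(\mathbb{R}^3)$ is set-representable, and $K$ possesses an order-determining set of two-valued states. Hence local finiteness is essential for the following statement, valid for locally finite OMLs $L$: if every finite subOML of $L$ has a two-valued state, then so does $L$. Namely, $L(\mathbb{R}^3)$ is not locally finite, and this implication fails for $L = L(\mathbb{R}^3)$. -/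

import Mathlib

universe u

/-- An orthomodular lattice (OML): a bounded lattice with an orthocomplementation `a ↦ aᶜ`
satisfying the orthomodular law. -/
class OrthomodularLattice (L : Type u) extends Lattice L, BoundedOrder L, Compl L where
  compl_compl' : ∀ a : L, aᶜᶜ = a
  compl_le_compl' : ∀ a b : L, a ≤ b → bᶜ ≤ aᶜ
  inf_compl' : ∀ a : L, a ⊓ aᶜ = ⊥
  sup_compl' : ∀ a : L, a ⊔ aᶜ = ⊤
  orthomodular' : ∀ a b : L, a ≤ b → a ⊔ (b ⊓ aᶜ) = b

/-- A subOML of an OML: a subset containing `0` and `1` that is closed under the lattice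
operations and the orthocomplementation of the ambient OML. -/
structure SubOML (L : Type u) [OrthomodularLattice L] where
  carrier : Set L
  bot_mem' : ⊥ ∈ carrier
  top_mem' : ⊤ ∈ carrier
  sup_mem' : ∀ a ∈ carrier, ∀ b ∈ carrier, a ⊔ b ∈ carrier
  inf_mem' : ∀ a ∈ carrier, ∀ b ∈ carrier, a ⊓ b ∈ carrier
  compl_mem' : ∀ a ∈ carrier, aᶜ ∈ carrier

namespace SubOML

variable {L : Type u} [OrthomodularLattice L]

instance : SetLike (SubOML L) L where
  coe := SubOML.carrier
  coe_injective K M h := by cases K; cases M; cases h; rfl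

/-- A subOML is an OML under the restricted order and operations. -/
instance (K : SubOML L) : OrthomodularLattice K where
  __ := (Subtype.lattice (P := fun a => a ∈ K) (fun {a b} ha hb => K.sup_mem' a ha b hb)
    (fun {a b} ha hb => K.inf_mem' a ha b hb))
  top := ⟨⊤, K.top_mem'⟩
  bot := ⟨⊥, K.bot_mem'⟩
  le_top a := (le_top : a.1 ≤ ⊤)
  bot_le a := (bot_le : ⊥ ≤ a.1)
  compl a := ⟨a.1ᶜ, K.compl_mem' a.1 a.2⟩
  compl_compl' a := Subtype.ext (OrthomodularLattice.compl_compl' a.1)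
  compl_le_compl' a b h := OrthomodularLattice.compl_le_compl' a.1 b.1 h
  inf_compl' a := Subtype.ext (OrthomodularLattice.inf_compl' a.1)
  sup_compl' a := Subtype.ext (OrthomodularLattice.sup_compl' a.1)
  orthomodular' a b h := Subtype.ext (OrthomodularLattice.orthomodular' a.1 b.1 h)

/-- The subOML generated by a subset `S`: the intersection of all subOMLs containing `S`. -/
def generatedBy (S : Set L) : SubOML L where
  carrier := {a | ∀ K : SubOML L, S ⊆ K.carrier → a ∈ K.carrier}
  bot_mem' K _ := K.bot_mem'
  top_mem' K _ := K.top_mem'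
  sup_mem' a ha b hb K h := K.sup_mem' a (ha K h) b (hb K h)
  inf_mem' a ha b hb K h := K.inf_mem' a (ha K h) b (hb K h)
  compl_mem' a ha K h := K.compl_mem' a (ha K h)

end SubOML

/-- An OML is locally finite if each finite subset generates a finite subOML. -/
def IsLocallyFiniteOML (L : Type u) [OrthomodularLattice L] : Prop :=
  ∀ S : Set L, S.Finite → Finite (SubOML.generatedBy S)

/-- A state on an OML: a `[0,1]`-valued function with `s 1 = 1`, additive on orthogonal pairs. -/
structure IsState {L : Type u} [OrthomodularLattice L] (s : L → ℝ) : Prop where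
  mem_unitInterval : ∀ a, s a ∈ Set.Icc (0 : ℝ) 1
  map_top : s ⊤ = 1
  map_sup : ∀ a b : L, a ≤ bᶜ → s (a ⊔ b) = s a + s b

/-- The set of all two-valued states on `L`, i.e. of all states with values in `{0, 1}`. -/
def twoValuedStates (L : Type u) [OrthomodularLattice L] : Set (L → ℝ) :=
  {s | IsState s ∧ ∀ a, s a = 0 ∨ s a = 1}

/-- A set `S` of real functions on `L` is order determining if `a ≤ b` holds as soon as
`s a ≤ s b` for all `s ∈ S`. (States are monotone, so the converse is automatic for them.) -/
def IsOrderDetermining {L : Type u} [OrthomodularLattice L] (S : Set (L → ℝ)) : Prop :=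
  ∀ a b : L, (∀ s ∈ S, s a ≤ s b) → a ≤ b

/-- A concrete logic on a set `X`: a family of subsets of `X` that contains `X` and is closed
under complements and under unions of disjoint pairs. It is ordered by inclusion. -/
structure IsConcreteLogic {X : Type u} (D : Set (Set X)) : Prop where
  univ_mem : Set.univ ∈ D
  compl_mem : ∀ A ∈ D, Aᶜ ∈ D
  union_mem : ∀ A ∈ D, ∀ B ∈ D, Disjoint A B → A ∪ B ∈ D

/-- An OML is set-representable if it is isomorphic to a concrete logic, by an order isomorphism
that carries the orthocomplement to the set-theoretic complement. (Joins of orthogonal elements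
are then carried to disjoint unions.) -/
def IsSetRepresentable (L : Type u) [OrthomodularLattice L] : Prop :=
  ∃ (X : Type u) (D : Set (Set X)), IsConcreteLogic D ∧
    ∃ e : L ≃o D, ∀ a : L, (e aᶜ : Set X) = (e a : Set X)ᶜ

/-- The OML of all linear subspaces of a finite-dimensional real inner product space, ordered by
inclusion, with the orthogonal complement as orthocomplementation. -/
noncomputable instance subspaceOML (E : Type u) [NormedAddCommGroup E] [InnerProductSpace ℝ E]
    [FiniteDimensional ℝ E] : OrthomodularLattice (Submodule ℝ E) where
  compl V := Vᗮ
  compl_compl' V := V.orthogonal_orthogonal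
  compl_le_compl' _ _ h := Submodule.orthogonal_le h
  inf_compl' V := V.inf_orthogonal_eq_bot
  sup_compl' _ := Submodule.sup_orthogonal_of_hasOrthogonalProjection
  orthomodular' V W h := by
    rw [inf_comm]
    exact Submodule.sup_orthogonal_inf_of_hasOrthogonalProjection h

/-- The OML `L(ℝ³)` of all linear subspaces of Euclidean 3-space. -/
abbrev LR3 : Type := Submodule ℝ (EuclideanSpace ℝ (Fin 3))

/-! A two-valued state that is one on a line is also one on every line at an angle of tangent at
most 1/√8 to it (`line_eq_one_of_small_angle`). Five such turns make a right angle, but orthogonal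
lines cannot both have value one. So every axis has value zero, while three orthogonal axes must sum
to one.

A subOML is closed under cross products of lines. Four lines in general position, two of them
orthogonal, therefore generate infinitely many lines, by the projective construction of adding one
(`SubOML.infinite_of_frame`); this also refutes local finiteness. Hence a finite subOML has a
direction `n` such that each member contains `n` or is orthogonal to it, so each member is
determined by whether it contains `n` and by its trace on the plane orthogonal to `n`.

Such a subOML has many two-valued states: one tests for `n`, others select one line from each
orthogonal pair in the plane by half-open quadrants. They determine the order, and sending an
element to the set of states with value one on it is a set representation. -/

open Module

/-! ### Coordinates in an orthonormal basis -/

section Coordinates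

variable {E : Type u} [NormedAddCommGroup E] [InnerProductSpace ℝ E]

/-- The vector with coordinates `x, y, z` in an orthonormal basis. -/
noncomputable def vec (b : OrthonormalBasis (Fin 3) ℝ E) (x y z : ℝ) : E :=
  x • b 0 + y • b 1 + z • b 2

/-- The line (or zero space) spanned by the vector with coordinates `x, y, z`. -/
noncomputable def line (b : OrthonormalBasis (Fin 3) ℝ E) (x y z : ℝ) : Submodule ℝ E :=
  Submodule.span ℝ {vec b x y z}

variable (b : OrthonormalBasis (Fin 3) ℝ E)

theorem inner_vec (x y z x' y' z' : ℝ) :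
    inner ℝ (vec b x y z) (vec b x' y' z') = x * x' + y * y' + z * z' := by
  have h := orthonormal_iff_ite.mp b.orthonormal
  simp only [vec, inner_add_left, inner_add_right, real_inner_smul_left, real_inner_smul_right, h]
  simp
  ring

theorem exists_eq_vec (v : E) : ∃ x y z, v = vec b x y z := by
  refine ⟨inner ℝ (b 0) v, inner ℝ (b 1) v, inner ℝ (b 2) v, ?_⟩
  conv_lhs => rw [← b.sum_repr' v, Fin.sum_univ_three]
  rfl

theorem vec_one_zero_zero : vec b 1 0 0 = b 0 := by simp [vec]

theorem vec_zero_one_zero : vec b 0 1 0 = b 1 := by simp [vec]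

theorem vec_zero_zero_one : vec b 0 0 1 = b 2 := by simp [vec]

theorem smul_vec (c x y z : ℝ) : c • vec b x y z = vec b (c * x) (c * y) (c * z) := by
  simp only [vec, smul_add, smul_smul]

theorem vec_add (x y z x' y' z' : ℝ) :
    vec b x y z + vec b x' y' z' = vec b (x + x') (y + y') (z + z') := by
  simp only [vec]; module

theorem vec_sub (x y z x' y' z' : ℝ) :
    vec b x y z - vec b x' y' z' = vec b (x - x') (y - y') (z - z') := by
  simp only [vec]; module

theorem vec_zero : vec b 0 0 0 = 0 := by simp [vec]

theorem vec_eq_zero {x y z : ℝ} : vec b x y z = 0 ↔ x = 0 ∧ y = 0 ∧ z = 0 := by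
  constructor
  · intro h
    have h' := inner_vec b x y z x y z
    rw [h, inner_zero_left] at h'
    refine ⟨?_, ?_, ?_⟩ <;> nlinarith [sq_nonneg x, sq_nonneg y, sq_nonneg z]
  · rintro ⟨rfl, rfl, rfl⟩
    exact vec_zero b

theorem vec_inj {x y z x' y' z' : ℝ} :
    vec b x y z = vec b x' y' z' ↔ x = x' ∧ y = y' ∧ z = z' := by
  rw [← sub_eq_zero, vec_sub, vec_eq_zero, sub_eq_zero, sub_eq_zero, sub_eq_zero]

theorem vec_mem_line {x y z x' y' z' : ℝ} :
    vec b x y z ∈ line b x' y' z' ↔ ∃ c, c * x' = x ∧ c * y' = y ∧ c * z' = z := by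
  simp only [line, Submodule.mem_span_singleton, smul_vec, vec_inj]

theorem line_smul {c : ℝ} (hc : c ≠ 0) (x y z : ℝ) :
    line b (c * x) (c * y) (c * z) = line b x y z := by
  rw [line, ← smul_vec, Submodule.span_singleton_smul_eq (IsUnit.mk0 c hc)]; rfl

theorem line_le_orthogonal {x y z x' y' z' : ℝ} (h : x * x' + y * y' + z * z' = 0) :
    line b x y z ≤ (line b x' y' z')ᗮ := by
  rw [line, Submodule.span_singleton_le_iff_mem, line, Submodule.mem_orthogonal_singleton_iff_inner_left,
    inner_vec, h]

/-- Two orthonormal vectors in a three-dimensional space extend to an orthonormal basis. -/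
theorem exists_orthonormalBasis_pair (b : OrthonormalBasis (Fin 3) ℝ E) {u v : E} (hu : ‖u‖ = 1) (hv : ‖v‖ = 1)
    (huv : inner ℝ u v = 0) : ∃ b' : OrthonormalBasis (Fin 3) ℝ E, b' 0 = u ∧ b' 1 = v := by
  have : FiniteDimensional ℝ E := b.toBasis.finiteDimensional_of_finite
  have hcard : finrank ℝ E = Fintype.card (Fin 3) := finrank_eq_card_basis b.toBasis
  have ho : Orthonormal ℝ (({0, 1} : Set (Fin 3)).domRestrict ![u, v, 0]) := by
    rw [orthonormal_iff_ite]
    rintro ⟨i, hi⟩ ⟨j, hj⟩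
    fin_cases i <;> fin_cases j <;> simp_all [real_inner_comm u v]
    obtain hi | hi := hi <;> exact absurd hi (by decide)
  obtain ⟨b', hb'⟩ := ho.exists_orthonormalBasis_extension_of_card_eq hcard
  exact ⟨b', hb' 0 (by simp), hb' 1 (by simp)⟩

end Coordinates

/-! ### The Kochen–Specker theorem -/

section KochenSpecker

variable {E : Type u} [NormedAddCommGroup E] [InnerProductSpace ℝ E] [FiniteDimensional ℝ E]
  (b : OrthonormalBasis (Fin 3) ℝ E) {s : Submodule ℝ E → ℝ}

theorem IsState.line_add_line_le (hs : IsState s) {x y z x' y' z' : ℝ}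
    (h : x * x' + y * y' + z * z' = 0) : s (line b x y z) + s (line b x' y' z') ≤ 1 := by
  rw [← hs.map_sup _ _ (line_le_orthogonal b h)]
  exact (hs.mem_unitInterval _).2

/-- A state sums to one on three pairwise orthogonal lines. -/
theorem IsState.sum_orthogonal_lines (hs : IsState s) {x₁ y₁ z₁ x₂ y₂ z₂ x₃ y₃ z₃ : ℝ}
    (n₁ : 0 < x₁ * x₁ + y₁ * y₁ + z₁ * z₁) (n₂ : 0 < x₂ * x₂ + y₂ * y₂ + z₂ * z₂)
    (n₃ : 0 < x₃ * x₃ + y₃ * y₃ + z₃ * z₃)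
    (h₁₂ : x₁ * x₂ + y₁ * y₂ + z₁ * z₂ = 0) (h₁₃ : x₁ * x₃ + y₁ * y₃ + z₁ * z₃ = 0)
    (h₂₃ : x₂ * x₃ + y₂ * y₃ + z₂ * z₃ = 0) :
    s (line b x₁ y₁ z₁) + s (line b x₂ y₂ z₂) + s (line b x₃ y₃ z₃) = 1 := by
  have hle : line b x₁ y₁ z₁ ⊔ line b x₂ y₂ z₂ ≤ (line b x₃ y₃ z₃)ᗮ :=
    sup_le (line_le_orthogonal b h₁₃) (line_le_orthogonal b h₂₃)
  have htop : line b x₁ y₁ z₁ ⊔ line b x₂ y₂ z₂ ⊔ line b x₃ y₃ z₃ = ⊤ := by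
    have hli : LinearIndependent ℝ ![vec b x₁ y₁ z₁, vec b x₂ y₂ z₂, vec b x₃ y₃ z₃] := by
      refine linearIndependent_of_ne_zero_of_inner_eq_zero ?_ ?_
      · intro i h0
        fin_cases i <;> obtain ⟨rfl, rfl, rfl⟩ := (vec_eq_zero b).1 h0 <;> simp at n₁ n₂ n₃
      · intro i j hij
        fin_cases i <;> fin_cases j <;> simp [inner_vec] at hij ⊢ <;> linarith
    have := hli.span_eq_top_of_card_eq_finrank (finrank_eq_card_basis b.toBasis).symm
    rw [← this]
    simp only [line, ← Submodule.span_union]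
    congr 1
    ext v
    simp [Matrix.range_cons]
  rw [← hs.map_sup _ _ (line_le_orthogonal b h₁₂), ← hs.map_sup _ _ hle]
  exact htop ▸ hs.map_top

/-- A two-valued state that is one on a line is one on all lines at a small angle to it. -/
theorem line_eq_one_of_small_angle (hs : s ∈ twoValuedStates (Submodule ℝ E)) {p q t : ℝ}
    (hpq : 0 < p ^ 2 + q ^ 2) (ht : 8 * t ^ 2 ≤ 1) (h : s (line b p q 0) = 1) :
    s (line b (p - t * q) (q + t * p) 0) = 1 := by
  obtain ⟨hs, h2⟩ := hs
  refine (h2 _).resolve_left fun hB => ?_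
  have nonneg (V) : 0 ≤ s V := (hs.mem_unitInterval V).1
  obtain ⟨r, hr0, hr⟩ : ∃ r : ℝ, 0 < r ∧ r ^ 2 = p ^ 2 + q ^ 2 :=
    ⟨√(p ^ 2 + q ^ 2), Real.sqrt_pos.2 hpq, Real.sq_sqrt hpq.le⟩
  -- This equation makes the vectors of `hH` for `y` and `-y` orthogonal. It is quadratic in `y ^ 2`
  -- with discriminant `1 - 8 * t ^ 2`, whence the bound on `t`.
  obtain ⟨y, hy0, hy⟩ : ∃ y : ℝ, 0 < y ∧ t ^ 2 + (t ^ 2 + y ^ 2) ^ 2 - y ^ 2 = 0 := by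
    have hd : 0 ≤ 1 - 8 * t ^ 2 := by linarith
    have hq := Real.sq_sqrt hd
    have hq0 := Real.sqrt_nonneg (1 - 8 * t ^ 2)
    have hu : 0 < (1 - 2 * t ^ 2 + √(1 - 8 * t ^ 2)) / 2 := by linarith
    refine ⟨√((1 - 2 * t ^ 2 + √(1 - 8 * t ^ 2)) / 2), Real.sqrt_pos.2 hu, ?_⟩
    rw [Real.sq_sqrt hu.le]
    linear_combination hq / 4
  have hF : s (line b 0 0 1) = 0 := by
    linarith [hs.line_add_line_le b (show p * 0 + q * 0 + 0 * 1 = 0 by ring), nonneg (line b 0 0 1)]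
  have hC : s (line b (-q - t * p) (p - t * q) 0) = 1 := by
    have hpos : 0 < (p ^ 2 + q ^ 2) * (1 + t ^ 2) := by positivity
    have := hs.sum_orthogonal_lines b (x₁ := p - t * q) (y₁ := q + t * p) (z₁ := 0)
      (x₂ := 0) (y₂ := 0) (z₂ := 1) (x₃ := -q - t * p) (y₃ := p - t * q) (z₃ := 0)
      (by linarith) (by norm_num) (by linarith) (by ring) (by ring) (by ring)
    linarith
  -- The third vector of an orthogonal triple whose other two have value zero: D is orthogonal to
  -- the line of `hC`, G to the given line.
  have hH (y : ℝ) (hy0 : y ≠ 0) :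
      s (line b (-(q * t) - p * (t ^ 2 + y ^ 2)) (p * t - q * (t ^ 2 + y ^ 2)) (r * y)) = 1 := by
    have hD : s (line b (-(q * t) + p) (p * t + q) (r * y)) = 0 := by
      linarith [hs.line_add_line_le b (show (-q - t * p) * (-(q * t) + p) +
        (p - t * q) * (p * t + q) + 0 * (r * y) = 0 by ring),
        nonneg (line b (-(q * t) + p) (p * t + q) (r * y))]
    have hG : s (line b (-(q * y)) (p * y) (-(r * t))) = 0 := by
      linarith [hs.line_add_line_le b (show p * (-(q * y)) + q * (p * y) + 0 * (-(r * t)) = 0 by ring),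
        nonneg (line b (-(q * y)) (p * y) (-(r * t)))]
    have e1 : 0 < (p ^ 2 + q ^ 2) * (1 + t ^ 2) + (r * y) ^ 2 := by positivity
    have e2 : 0 < (p ^ 2 + q ^ 2) * y ^ 2 + (r * t) ^ 2 := by positivity
    have e3 : 0 < (p ^ 2 + q ^ 2) * (t ^ 2 + (t ^ 2 + y ^ 2) ^ 2) + (r * y) ^ 2 := by positivity
    have := hs.sum_orthogonal_lines b (x₁ := -(q * t) + p) (y₁ := p * t + q) (z₁ := r * y)
      (x₂ := -(q * y)) (y₂ := p * y) (z₂ := -(r * t))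
      (x₃ := -(q * t) - p * (t ^ 2 + y ^ 2)) (y₃ := p * t - q * (t ^ 2 + y ^ 2)) (z₃ := r * y)
      (by linarith) (by linarith) (by linarith)
      (by linear_combination -t * y * hr) (by linear_combination y ^ 2 * hr)
      (by linear_combination -t * y * hr)
    linarith
  have h1 := hH y hy0.ne'
  have h3 := hH (-y) (neg_ne_zero.2 hy0.ne')
  have := hs.line_add_line_le b (show
    (-(q * t) - p * (t ^ 2 + y ^ 2)) * (-(q * t) - p * (t ^ 2 + (-y) ^ 2)) +
    (p * t - q * (t ^ 2 + y ^ 2)) * (p * t - q * (t ^ 2 + (-y) ^ 2)) + (r * y) * (r * -y) = 0 by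
      linear_combination (p ^ 2 + q ^ 2) * hy - y ^ 2 * hr)
  linarith

/-- Five small turns in one plane would carry the value one to an orthogonal line. -/
theorem line_one_zero_zero_ne_one (hs : s ∈ twoValuedStates (Submodule ℝ E)) :
    s (line b 1 0 0) ≠ 1 := by
  intro h0
  have h1 := line_eq_one_of_small_angle b hs (t := 1 / 3) (by norm_num) (by norm_num) h0
  have h2 := line_eq_one_of_small_angle b hs (t := 1 / 3) (by norm_num) (by norm_num) h1
  have h3 := line_eq_one_of_small_angle b hs (t := 1 / 3) (by norm_num) (by norm_num) h2
  have h4 := line_eq_one_of_small_angle b hs (t := 1 / 3) (by norm_num) (by norm_num) h3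
  -- Since (3 + i)⁴ = 28 + 96i, four turns of tangent 1/3 make an angle of tangent 24/7; its
  -- complement has tangent 7/24.
  have h5 := line_eq_one_of_small_angle b hs (t := 7 / 24) (by norm_num) (by norm_num) h4
  norm_num at h5
  have := hs.1.line_add_line_le b (x := 1) (y := 0) (z := 0) (x' := 0) (z' := 0) (by norm_num)
    |>.trans_eq' (congrArg₂ (· + ·) h0 h5)
  norm_num at this

/-- The **Kochen–Specker theorem**: the subspaces of a three-dimensional real inner product
space admit no two-valued state. -/
theorem twoValuedStates_submodule_eq_empty (b : OrthonormalBasis (Fin 3) ℝ E) :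
    twoValuedStates (Submodule ℝ E) = ∅ := by
  refine Set.eq_empty_of_forall_notMem fun s hs => ?_
  have hz (i : Fin 3) : s (Submodule.span ℝ {b i}) = 0 := by
    refine (hs.2 _).resolve_right fun h => line_one_zero_zero_ne_one (b.reindex (Equiv.swap i 0)) hs ?_
    rw [line, vec_one_zero_zero]
    simpa using h
  have := hs.1.sum_orthogonal_lines b (x₁ := 1) (y₁ := 0) (z₁ := 0) (x₂ := 0) (y₂ := 1) (z₂ := 0)
    (x₃ := 0) (y₃ := 0) (z₃ := 1) (by simp) (by simp) (by simp) (by simp) (by simp) (by simp)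
  simp only [line, vec_one_zero_zero, vec_zero_one_zero, vec_zero_zero_one, hz] at this
  norm_num at this

end KochenSpecker

/-! ### Finite subOMLs have a central direction -/

section FiniteSubOML

variable {E : Type u} [NormedAddCommGroup E] [InnerProductSpace ℝ E] [FiniteDimensional ℝ E]
  (b : OrthonormalBasis (Fin 3) ℝ E) (K : SubOML (Submodule ℝ E))

/-- A subOML of subspaces is closed under the cross product of lines. -/
theorem SubOML.line_cross_mem {x y z x' y' z' : ℝ} (h : line b x y z ∈ K)
    (h' : line b x' y' z' ∈ K) :
    line b (y * z' - z * y') (z * x' - x * z') (x * y' - y * x') ∈ K := by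
  by_cases h0 : vec b (y * z' - z * y') (z * x' - x * z') (x * y' - y * x') = 0
  · rw [line, h0, Submodule.span_zero_singleton]
    exact K.bot_mem'
  · have hc : line b (y * z' - z * y') (z * x' - x * z') (x * y' - y * x') =
        (line b x y z ⊔ line b x' y' z')ᗮ := by
      refine le_antisymm ?_ ?_
      · rw [← Submodule.inf_orthogonal]
        exact le_inf (line_le_orthogonal b (by ring)) (line_le_orthogonal b (by ring))
      · rw [← Submodule.inf_orthogonal]
        rintro u ⟨hu, hu'⟩
        obtain ⟨p, q, r, rfl⟩ := exists_eq_vec b u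
        simp only [line, SetLike.mem_coe, Submodule.mem_orthogonal_singleton_iff_inner_right,
          inner_vec] at hu hu'
        rw [vec_mem_line]
        set X := y * z' - z * y' with hX
        set Y := z * x' - x * z' with hY
        set Z := x * y' - y * x' with hZ
        have hN : X ^ 2 + Y ^ 2 + Z ^ 2 ≠ 0 := by
          contrapose! h0
          rw [vec_eq_zero]
          refine ⟨?_, ?_, ?_⟩ <;> nlinarith [sq_nonneg X, sq_nonneg Y, sq_nonneg Z]
        -- The cross product of `u` with the normal (X, Y, Z) vanishes, because `u` is orthogonal to
        -- both factors of that normal.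
        have e1 : q * Z - r * Y = 0 := by
          rw [hY, hZ]; linear_combination x * hu' - x' * hu
        have e2 : r * X - p * Z = 0 := by
          rw [hX, hZ]; linear_combination y * hu' - y' * hu
        have e3 : p * Y - q * X = 0 := by
          rw [hX, hY]; linear_combination z * hu' - z' * hu
        refine ⟨(p * X + q * Y + r * Z) / (X ^ 2 + Y ^ 2 + Z ^ 2), ?_, ?_, ?_⟩ <;> field_simp
        · linear_combination Z * e2 - Y * e3
        · linear_combination X * e3 - Z * e1
        · linear_combination Y * e1 - X * e2
    rw [hc]
    exact K.compl_mem' _ (K.sup_mem' _ h _ h')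

theorem SubOML.line_mem_of_smul {c : ℝ} (hc : c ≠ 0) {x y z x' y' z' : ℝ} (h : line b x' y' z' ∈ K)
    (hx : x' = c * x) (hy : y' = c * y) (hz : z' = c * z) : line b x y z ∈ K := by
  subst hx hy hz
  rwa [line_smul b hc] at h

/-- A subOML containing a frame of the projective plane that includes an orthogonal triple
is infinite. -/
theorem SubOML.infinite_of_frame {s t : ℝ} (hs : s ≠ 0) (ht : t ≠ 0) (h₁ : line b 1 0 0 ∈ K)
    (h₃ : line b 0 0 1 ∈ K) (hd : line b 1 s 0 ∈ K) (hc : line b 1 0 t ∈ K) : Infinite K := by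
  have h₂ : line b 0 1 0 ∈ K := by simpa using K.line_cross_mem b h₃ h₁
  -- This is (0, t, s) up to scale, the normal of the plane through (1, 0, 0) and (0, s, -t), the
  -- latter being the difference of the last two given vectors.
  have hA := K.line_cross_mem b h₁ (K.line_cross_mem b h₁ (K.line_cross_mem b hd hc))
  have hp (k : ℕ) : line b k s 0 ∈ K := by
    induction k with
    | zero =>
      exact K.line_mem_of_smul b (inv_ne_zero hs) h₂ (by simp) (by simp [hs]) (by simp)
    -- The plane through (k, s, 0) and (0, 0, 1) meets the plane normal to `hA` in (k, s, -t).
    -- Adding (1, 0, t) gives (k + 1, s, 0), which is where the plane of these two vectors meets z =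
    -- 0.
    | succ k ih =>
      have hq := K.line_cross_mem b (K.line_cross_mem b h₃ ih) hA
      have := K.line_cross_mem b h₃ (K.line_cross_mem b hq hc)
      refine K.line_mem_of_smul b (c := s * t) (mul_ne_zero hs ht) this ?_ ?_ ?_ <;>
        push_cast <;> ring
  refine Infinite.of_injective (fun k : ℕ => (⟨line b k s 0, hp k⟩ : K)) fun k l hkl => ?_
  have hmem : vec b k s 0 ∈ line b l s 0 := by
    have hkl' : line b k s 0 = line b l s 0 := Subtype.ext_iff.1 hkl
    rw [← hkl']
    exact Submodule.mem_span_singleton_self _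
  obtain ⟨c, h1, h2, -⟩ := (vec_mem_line b).1 hmem
  have : c = 1 := mul_right_cancel₀ hs (by linarith)
  subst this
  exact_mod_cast (one_mul (l : ℝ) ▸ h1).symm

/-- A vector that is neither in nor orthogonal to some member of a subOML is neither parallel nor
orthogonal to some line of the subOML. -/
theorem SubOML.exists_oblique_line (b : OrthonormalBasis (Fin 3) ℝ E)
    (K : SubOML (Submodule ℝ E)) {n : E} {V : Submodule ℝ E} (hV : V ∈ K) (hn : n ∉ V)
    (hn' : ¬ V ≤ (Submodule.span ℝ {n})ᗮ) :
    ∃ a, Submodule.span ℝ {a} ∈ K ∧ inner ℝ n a ≠ 0 ∧ n ∉ Submodule.span ℝ {a} := by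
  have h3 : finrank ℝ E = 3 := by simpa using finrank_eq_card_basis b.toBasis
  obtain ⟨v, hv, hnv⟩ : ∃ v ∈ V, inner ℝ n v ≠ 0 := by
    by_contra! h
    exact hn' fun v hv => Submodule.mem_orthogonal_singleton_iff_inner_right.2 (h v hv)
  have hv0 : v ≠ 0 := by rintro rfl; simp at hnv
  have hsum := V.finrank_add_finrank_orthogonal
  have hlt : finrank ℝ V < 3 := h3 ▸ Submodule.finrank_lt (by rintro rfl; exact hn trivial)
  have hpos : 0 < finrank ℝ V := by
    rw [Module.finrank_pos_iff_exists_ne_zero]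
    exact ⟨⟨v, hv⟩, by simpa using hv0⟩
  -- In dimension three a nonzero proper subspace or its complement is a line; the two obliqueness
  -- conditions trade places under complementation.
  obtain hd | hd : finrank ℝ V = 1 ∨ finrank ℝ Vᗮ = 1 := by omega
  · have : V = Submodule.span ℝ {v} := by
      symm
      refine Submodule.eq_of_le_of_finrank_eq ((Submodule.span_singleton_le_iff_mem _ _).2 hv) ?_
      rw [hd, finrank_span_singleton hv0]
    subst this
    exact ⟨v, hV, hnv, hn⟩
  · obtain ⟨a, ha⟩ := ((Submodule.finrank_le_one_iff_isPrincipal _).1 hd.le).principal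
    have hVa : V = (Submodule.span ℝ {a})ᗮ := by rw [← ha, Submodule.orthogonal_orthogonal]
    refine ⟨a, ha ▸ K.compl_mem' _ hV, fun h => hn ?_, fun h => hnv ?_⟩
    · rwa [hVa, Submodule.mem_orthogonal_singleton_iff_inner_left]
    · rw [← ha] at h
      exact Submodule.inner_left_of_mem_orthogonal hv h

/-- A finite subOML of the subspaces of a three-dimensional space has a direction `n` with which
all its members are compatible. -/
theorem SubOML.exists_central_direction (b : OrthonormalBasis (Fin 3) ℝ E)
    (K : SubOML (Submodule ℝ E)) [Finite K] :
    ∃ n : E, ‖n‖ = 1 ∧ ∀ V ∈ K, n ∈ V ∨ V ≤ (Submodule.span ℝ {n})ᗮ := by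
  by_contra! H
  have hob (n : E) (hn : ‖n‖ = 1) :
      ∃ a, Submodule.span ℝ {a} ∈ K ∧ inner ℝ n a ≠ 0 ∧ n ∉ Submodule.span ℝ {a} := by
    obtain ⟨V, hV, h1, h2⟩ := H n hn
    exact K.exists_oblique_line b hV h1 h2
  -- Used only to find some line in `K`, which then becomes the first axis.
  obtain ⟨a₀, ha₀, ha₀', -⟩ := hob (b 0) (b.orthonormal.1 0)
  have ha₀n : a₀ ≠ 0 := by rintro rfl; simp at ha₀'
  obtain ⟨n, hn, hnK⟩ : ∃ n : E, ‖n‖ = 1 ∧ Submodule.span ℝ {n} ∈ K := by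
    refine ⟨‖a₀‖⁻¹ • a₀, norm_smul_inv_norm ha₀n, ?_⟩
    rwa [Submodule.span_singleton_smul_eq (IsUnit.mk0 _ (by simpa using ha₀n))]
  obtain ⟨a, haK, hna, hna'⟩ := hob n hn
  have hw : a - inner ℝ n a • n ≠ 0 := fun h => hna' <| by
    rw [Submodule.mem_span_singleton]
    refine ⟨(inner ℝ n a)⁻¹, ?_⟩
    rw [inv_smul_eq_iff₀ hna]
    exact sub_eq_zero.1 h
  obtain ⟨b', hb0, hb1⟩ := exists_orthonormalBasis_pair b hn
    (v := ‖a - inner ℝ n a • n‖⁻¹ • (a - inner ℝ n a • n)) (norm_smul_inv_norm hw)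
    (by simp [inner_smul_right, inner_sub_right, hn])
  have hav : a = vec b' (inner ℝ n a) ‖a - inner ℝ n a • n‖ 0 := by
    rw [vec, hb0, hb1, smul_inv_smul₀ (norm_ne_zero_iff.2 hw)]
    simp
  set x := inner ℝ n a
  set y := ‖a - x • n‖ with hy
  have hy0 : y ≠ 0 := norm_ne_zero_iff.2 hw
  clear_value x y
  have h1 : line b' 1 0 0 ∈ K := by rwa [line, vec_one_zero_zero, hb0]
  have hxy : line b' x y 0 ∈ K := by rwa [line, ← hav]
  have h3 : line b' 0 0 1 ∈ K :=
    K.line_mem_of_smul b' hy0 (K.line_cross_mem b' h1 hxy) (by ring) (by ring) (by ring)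
  have h2 : line b' 0 1 0 ∈ K := by simpa using K.line_cross_mem b' h3 h1
  obtain ⟨c, hcK, hc, hc'⟩ := hob (b' 2) (b'.orthonormal.1 2)
  obtain ⟨p, q, r, rfl⟩ := exists_eq_vec b' c
  rw [← vec_zero_zero_one, inner_vec] at hc
  have hr : r ≠ 0 := by simpa using hc
  have hpq : p ≠ 0 ∨ q ≠ 0 := by
    by_contra! h
    obtain ⟨rfl, rfl⟩ := h
    refine hc' ?_
    rw [← vec_zero_zero_one]
    exact (vec_mem_line b').2 ⟨r⁻¹, by simp, by simp, inv_mul_cancel₀ hr⟩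
  have hpqr : line b' p q r ∈ K := hcK
  have hd : line b' 1 (y / x) 0 ∈ K :=
    K.line_mem_of_smul b' hna hxy (by ring) (by field_simp) (by ring)
  -- The plane y = 0 is met in such a line by the plane of (0, 1, 0) and (p, q, r) if `p ≠ 0`, and
  -- by the plane of (x, y, 0) and (0, q, r) if `p = 0`.
  obtain ⟨t, ht0, ht⟩ : ∃ t, t ≠ 0 ∧ line b' 1 0 t ∈ K := by
    by_cases hp : p = 0
    · have hq := hpq.resolve_left (not_not.2 hp)
      refine ⟨-(y * r) / (x * q), div_ne_zero (neg_ne_zero.2 (mul_ne_zero hy0 hr)) (mul_ne_zero hna hq), ?_⟩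
      exact K.line_mem_of_smul b' (mul_ne_zero hna hq)
        (K.line_cross_mem b' h2 (K.line_cross_mem b' hxy hpqr))
        (by rw [hp]; ring) (by ring) (by field_simp; ring)
    · refine ⟨r / p, div_ne_zero hr hp, ?_⟩
      exact K.line_mem_of_smul b' hp
        (K.line_cross_mem b' (K.line_cross_mem b' h2 hpqr) h2)
        (by ring) (by ring) (by field_simp; ring)
  exact (K.infinite_of_frame b' (div_ne_zero hy0 hna) ht0 h1 h3 hd ht).not_finite ‹_›

end FiniteSubOML

/-! ### From order-determining states to set representations -/

section SetRepresentation

variable {L : Type u} [OrthomodularLattice L]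

/-- An OML with an order-determining set of two-valued states is set-representable. -/
theorem IsOrderDetermining.isSetRepresentable {S : Set (L → ℝ)} (hS : S ⊆ twoValuedStates L)
    (h : IsOrderDetermining S) : IsSetRepresentable L := by
  let f (a : L) : Set S := {s | s.1 a = 1}
  have hcompl (a : L) : f aᶜ = (f a)ᶜ := by
    ext ⟨s, hs⟩
    have h1 := (hS hs).1.map_sup a aᶜ (OrthomodularLattice.compl_compl' a).ge
    rw [OrthomodularLattice.sup_compl', (hS hs).1.map_top] at h1
    have h2 := (hS hs).2 a
    change s aᶜ = 1 ↔ ¬ s a = 1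
    rcases h2 with h2 | h2 <;> rw [h2] at h1 ⊢ <;> norm_num at h1 ⊢
    all_goals linarith
  have hle {a c : L} : f a ⊆ f c ↔ a ≤ c := by
    refine ⟨fun hac => h a c fun s hs => ?_, ?_⟩
    · rcases (hS hs).2 a with h0 | h1
      · exact h0 ▸ ((hS hs).1.mem_unitInterval c).1
      · exact le_of_eq (h1.trans (@hac ⟨s, hs⟩ h1).symm)
    · rintro hac ⟨s, hs⟩ (hsa : s a = 1)
      have h1 := (hS hs).1.map_sup a cᶜ (by rwa [OrthomodularLattice.compl_compl'])
      have h2 := ((hS hs).1.mem_unitInterval (a ⊔ cᶜ)).2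
      have h3 := ((hS hs).1.mem_unitInterval cᶜ).1
      by_contra hc
      have : (⟨s, hs⟩ : S) ∈ f cᶜ := hcompl c ▸ hc
      have : s cᶜ = 1 := this
      linarith
  refine ⟨S, Set.range f, ⟨⟨⊤, ?_⟩, ?_, ?_⟩, ?_⟩
  · exact Set.eq_univ_of_forall fun s => (hS s.2).1.map_top
  · rintro _ ⟨a, rfl⟩
    exact ⟨aᶜ, hcompl a⟩
  · rintro _ ⟨a, rfl⟩ _ ⟨c, rfl⟩ hd
    have hac : a ≤ cᶜ := hle.1 (hcompl c ▸ hd.subset_compl_right)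
    refine ⟨a ⊔ c, ?_⟩
    ext ⟨s, hs⟩
    change s (a ⊔ c) = 1 ↔ s a = 1 ∨ s c = 1
    have h1 := (hS hs).1.map_sup a c hac
    have h2 := ((hS hs).1.mem_unitInterval (a ⊔ c)).2
    rcases (hS hs).2 a with ha | ha <;> rcases (hS hs).2 c with hc | hc <;>
      rw [ha, hc] at h1 <;> rw [h1] at h2 ⊢ <;> norm_num at h2 <;> norm_num [ha, hc]
  · let e : L ↪o Set S := OrderEmbedding.ofMapLEIff f fun _ _ => hle
    exact ⟨e.orderIso, hcompl⟩

/-- A property of the members of an OML that holds for an orthogonal join exactly when it holds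
for one of its two parts, and never for both, gives a two-valued state. -/
theorem indicator_mem_twoValuedStates {P : L → Prop} [DecidablePred P] (htop : P ⊤)
    (hdisj : ∀ a c, a ≤ cᶜ → P a → ¬ P c) (hsup : ∀ a c, a ≤ cᶜ → (P (a ⊔ c) ↔ P a ∨ P c)) :
    (fun a => if P a then (1 : ℝ) else 0) ∈ twoValuedStates L := by
  refine ⟨⟨fun a => ?_, if_pos htop, fun a c hac => ?_⟩, fun a => ?_⟩
  · split_ifs <;> simp
  · have h1 := hdisj a c hac
    have h2 := hsup a c hac
    by_cases ha : P a <;> by_cases hc : P c <;> simp_all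
  · by_cases ha : P a <;> simp [ha]

end SetRepresentation

/-! ### States on finite subOMLs, and the failure of local finiteness -/

section States

variable {E : Type u} [NormedAddCommGroup E] [InnerProductSpace ℝ E] [FiniteDimensional ℝ E]
  {K : SubOML (Submodule ℝ E)} {n : E}

open Classical in
/-- The state concentrated in a direction compatible with all members of a subOML. -/
noncomputable def directionState (K : SubOML (Submodule ℝ E)) (n : E) (V : K) : ℝ :=
  if n ∈ V.1 then 1 else 0

/-- If neither of two members contains `n`, both are orthogonal to `n`, hence so is their join; this
gives additivity. -/
theorem directionState_mem (hn : ‖n‖ = 1)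
    (hK : ∀ V ∈ K, n ∈ V ∨ V ≤ (Submodule.span ℝ {n})ᗮ) :
    directionState K n ∈ twoValuedStates K := by
  classical
  have hn0 : inner ℝ n n ≠ 0 := by simp [hn]
  refine indicator_mem_twoValuedStates (P := fun V : K => n ∈ V.1) trivial ?_ ?_
  · intro V W hVW hV hW
    exact hn0 (Submodule.inner_left_of_mem_orthogonal hW (hVW hV))
  · refine fun V W _ => ⟨fun h => ?_, fun h => h.elim (fun h => le_sup_left (a := V.1) h)
      (fun h => le_sup_right (b := W.1) h)⟩
    by_contra! hVW
    have := sup_le ((hK V.1 V.2).resolve_left hVW.1) ((hK W.1 W.2).resolve_left hVW.2) h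
    exact hn0 (Submodule.mem_orthogonal_singleton_iff_inner_right.1 this)

/-- `V` contains a vector of the plane orthogonal to `b 0` that lies in the half-open quadrants
which contain `b 1` and whose orientation is given by the sign of `ε`. -/
def MeetsQuadrant (b : OrthonormalBasis (Fin 3) ℝ E) (ε : ℝ) (V : Submodule ℝ E) : Prop :=
  ∃ y z, vec b 0 y z ∈ V ∧ y ≠ 0 ∧ 0 ≤ ε * (y * z)

open Classical in
/-- The state on a subOML given by the lines that meet a pair of opposite quadrants of a plane. -/
noncomputable def quadrantState (K : SubOML (Submodule ℝ E)) (b : OrthonormalBasis (Fin 3) ℝ E)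
    (ε : ℝ) (V : K) : ℝ :=
  if MeetsQuadrant b ε V.1 then 1 else 0

variable {b : OrthonormalBasis (Fin 3) ℝ E} {ε : ℝ}

/-- Members of `K` contain, with each of their vectors, its projection to the plane orthogonal to
`b 0`. -/
theorem vec_zero_mem_of_mem (hK : ∀ V ∈ K, b 0 ∈ V ∨ V ≤ (Submodule.span ℝ {b 0})ᗮ)
    {V : Submodule ℝ E} (hV : V ∈ K) {x y z : ℝ} (h : vec b x y z ∈ V) : vec b 0 y z ∈ V := by
  rcases hK V hV with h0 | h0
  · rw [← vec_one_zero_zero] at h0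
    have := V.sub_mem h (V.smul_mem x h0)
    rwa [smul_vec, vec_sub, show x - x * 1 = 0 by ring, mul_zero, sub_zero, sub_zero]
      at this
  · have := Submodule.mem_orthogonal_singleton_iff_inner_right.1 (h0 h)
    rw [← vec_one_zero_zero, inner_vec] at this
    obtain rfl : x = 0 := by linarith
    exact h

/-- Orthogonal vectors (y, z) and (y', z') satisfy (yz)(y'z') = -(yy')², so when `y` and `y'` are
nonzero they lie in differently oriented quadrants. This gives disjointness, and also shows that a
join meets the quadrants only if one part does. -/
theorem quadrantState_mem (hε : ε ≠ 0)
    (hK : ∀ V ∈ K, b 0 ∈ V ∨ V ≤ (Submodule.span ℝ {b 0})ᗮ) :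
    quadrantState K b ε ∈ twoValuedStates K := by
  classical
  refine indicator_mem_twoValuedStates (P := fun V : K => MeetsQuadrant b ε V.1)
    ⟨1, 0, trivial, one_ne_zero, by simp⟩ ?_ ?_
  · rintro V W hVW ⟨y, z, hv, hy, hyz⟩ ⟨y', z', hw, hy', hyz'⟩
    have h0 := Submodule.inner_left_of_mem_orthogonal hw (hVW hv)
    rw [inner_vec] at h0
    have h1 := mul_nonneg hyz hyz'
    have h2 : 0 < (ε * y * y') ^ 2 := by positivity
    have h3 : ε * (y * z) * (ε * (y' * z')) = -(ε * y * y') ^ 2 := by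
      linear_combination ε ^ 2 * y * y' * h0
    linarith
  · refine fun V W hVW => ⟨?_, ?_⟩
    · rintro ⟨y, z, hv, hy, hyz⟩
      obtain ⟨v, hvV, w, hwW, hvw⟩ := Submodule.mem_sup.1 (show vec b 0 y z ∈ V.1 ⊔ W.1 from hv)
      obtain ⟨p, q, r, rfl⟩ := exists_eq_vec b v
      obtain ⟨p', q', r', rfl⟩ := exists_eq_vec b w
      rw [vec_add, vec_inj] at hvw
      replace hvV := vec_zero_mem_of_mem hK V.2 hvV
      replace hwW := vec_zero_mem_of_mem hK W.2 hwW
      have h0 := Submodule.inner_left_of_mem_orthogonal hwW (hVW hvV)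
      rw [inner_vec] at h0
      obtain ⟨-, rfl, rfl⟩ := hvw
      by_contra! hno
      have hV : q ≠ 0 → ε * (q * r) < 0 := fun hq => by
        by_contra! h; exact hno.1 ⟨q, r, hvV, hq, h⟩
      have hW : q' ≠ 0 → ε * (q' * r') < 0 := fun hq => by
        by_contra! h; exact hno.2 ⟨q', r', hwW, hq, h⟩
      -- If one part is zero or lies on the second axis, orthogonality reduces the sum to the other
      -- part or puts the other part on the first axis, which belongs to the quadrants. Otherwise
      -- both parts would lie in the same opposite pair of quadrants.
      by_cases hq : q = 0
      · subst hq
        have hq' : q' ≠ 0 := by simpa using hy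
        have hW := hW hq'
        have : r * r' = 0 := by linarith
        rcases mul_eq_zero.1 this with rfl | rfl
        · simp at hyz; linarith
        · simp at hW
      · have hV := hV hq
        by_cases hq' : q' = 0
        · subst hq'
          have : r * r' = 0 := by linarith
          rcases mul_eq_zero.1 this with rfl | rfl
          · simp at hV
          · simp at hyz; linarith
        · have h1 := mul_pos_of_neg_of_neg hV (hW hq')
          have h2 : 0 < (ε * q * q') ^ 2 := by positivity
          have h3 : ε * (q * r) * (ε * (q' * r')) = -(ε * q * q') ^ 2 := by
            linear_combination ε ^ 2 * q * q' * h0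
          linarith
    · rintro (⟨y, z, hv, h⟩ | ⟨y, z, hv, h⟩)
      · exact ⟨y, z, le_sup_left (a := V.1) hv, h⟩
      · exact ⟨y, z, le_sup_right (b := W.1) hv, h⟩

/-- The two-valued states of a finite subOML of the subspaces of a three-dimensional space are
order determining. -/
theorem SubOML.isOrderDetermining_twoValuedStates (b : OrthonormalBasis (Fin 3) ℝ E)
    (K : SubOML (Submodule ℝ E)) [Finite K] : IsOrderDetermining (twoValuedStates K) := by
  obtain ⟨n, hn, hK⟩ := K.exists_central_direction b
  rintro ⟨V, hV⟩ ⟨W, hW⟩ h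
  have hdir : n ∈ V → n ∈ W := fun hnV => by
    by_contra hnW
    have := h _ (directionState_mem hn hK)
    norm_num [directionState, hnV, hnW] at this
  suffices hperp : ∀ v ∈ V, inner ℝ n v = 0 → v ∈ W by
    intro v hv
    rcases hK V hV with hnV | hnV
    · have := hperp (v - inner ℝ n v • n) (V.sub_mem hv (V.smul_mem _ hnV))
        (by simp [inner_sub_right, inner_smul_right, hn])
      simpa using W.add_mem this (W.smul_mem (inner ℝ n v) (hdir hnV))
    · exact hperp v hv (Submodule.mem_orthogonal_singleton_iff_inner_right.1 (hnV hv))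
  intro v hv hnv
  by_cases hv0 : v = 0
  · exact hv0 ▸ W.zero_mem
  have hv0' : ‖v‖⁻¹ ≠ 0 := by simpa using hv0
  obtain ⟨b, rfl, hb⟩ := exists_orthonormalBasis_pair b hn (v := ‖v‖⁻¹ • v)
    (norm_smul_inv_norm hv0) (by simp [inner_smul_right, hnv])
  have hbV : vec b 0 1 0 ∈ V := by
    rw [vec_zero_one_zero, hb]
    exact V.smul_mem _ hv
  suffices hbW : vec b 0 1 0 ∈ W by
    rwa [vec_zero_one_zero, hb, W.smul_mem_iff hv0'] at hbW
  -- The quadrant pairs of both orientations share only the axis of `b 1`. So `W`, meeting both,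
  -- either contains that axis as the common line or contains two independent vectors of the plane.
  have hq (ε : ℝ) (hε : ε ≠ 0) : MeetsQuadrant b ε W := by
    have hVq : MeetsQuadrant b ε V := ⟨1, 0, hbV, one_ne_zero, by simp⟩
    by_contra hWq
    have := h _ (quadrantState_mem hε hK)
    norm_num [quadrantState, hVq, hWq] at this
  obtain ⟨y, z, hw, hy, hyz⟩ := hq 1 one_ne_zero
  obtain ⟨y', z', hw', hy', hyz'⟩ := hq (-1) (by norm_num)
  by_cases hD : y * z' - y' * z = 0
  · have hz' : z' = 0 := by
      have h1 : (y * z') ^ 2 = (y * z) * (y' * z') := by linear_combination y * z' * hD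
      have h2 : (y * z) * (y' * z') ≤ 0 := mul_nonpos_of_nonneg_of_nonpos (by linarith) (by linarith)
      have h3 : y * z' = 0 := by nlinarith
      exact (mul_eq_zero.1 h3).resolve_left hy
    have := W.smul_mem y'⁻¹ hw'
    rwa [smul_vec, hz', inv_mul_cancel₀ hy', mul_zero] at this
  · have := W.smul_mem (y * z' - y' * z)⁻¹ (W.sub_mem (W.smul_mem z' hw) (W.smul_mem z hw'))
    rw [smul_vec, smul_vec, vec_sub, smul_vec] at this
    convert this using 2
    · ring
    · field_simp
    · ring

/-- The subspaces of a three-dimensional space do not form a locally finite OML. -/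
theorem not_isLocallyFiniteOML_submodule (b : OrthonormalBasis (Fin 3) ℝ E) :
    ¬ IsLocallyFiniteOML (Submodule ℝ E) := by
  intro h
  let S : Set (Submodule ℝ E) := {line b 1 0 0, line b 0 0 1, line b 1 1 0, line b 1 0 1}
  have hS : S ⊆ (SubOML.generatedBy S).carrier := fun V hV K hK => hK hV
  refine ((SubOML.generatedBy S).infinite_of_frame b one_ne_zero one_ne_zero (hS ?_) (hS ?_) (hS ?_)
    (hS ?_)).not_finite (h S (by simp [S])) <;> simp [S]

end States

/-- `L(ℝ³)` has no two-valued state, every finite subOML of it is set-representable and has an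
order-determining set of two-valued states; local finiteness is essential: `L(ℝ³)` is not locally
finite, and the implication "if every finite subOML has a two-valued state, then so does the whole
OML", which holds for locally finite OMLs, fails for it. -/
theorem theorem1p3 :
    twoValuedStates LR3 = ∅ ∧
    (∀ K : SubOML LR3, Finite K →
      IsSetRepresentable K ∧
      ∃ S : Set (K → ℝ), S ⊆ twoValuedStates K ∧ IsOrderDetermining S) ∧
    (¬ IsLocallyFiniteOML LR3 ∧
      ¬ ((∀ K : SubOML LR3, Finite K → (twoValuedStates K).Nonempty) →
          (twoValuedStates LR3).Nonempty)) := by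
  have b := EuclideanSpace.basisFun (Fin 3) ℝ
  have hempty := twoValuedStates_submodule_eq_empty b
  refine ⟨hempty, fun K _ => ?_, not_isLocallyFiniteOML_submodule b, fun h => ?_⟩
  · have hK := K.isOrderDetermining_twoValuedStates b
    exact ⟨hK.isSetRepresentable subset_rfl, _, subset_rfl, hK⟩
  · refine (h fun K _ => ?_).ne_empty hempty
    by_contra hK
    -- If the order-determining set were empty, every inequality would hold vacuously.
    have htop : (⊤ : K) ≤ ⊥ := K.isOrderDetermining_twoValuedStates b _ _ fun s hs => (hK ⟨s, hs⟩).elim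
    exact bot_ne_top (α := LR3) (top_le_iff.1 (show (⊤ : LR3) ≤ ⊥ from htop))
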